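/- All spaces are separable and metrizable. A metric space is *proper* if its closed balls are compact. A locally compact space $X$ is an *absolute neighborhood retract* (ANR) if, whenever $X$ is embedded as a closed subset of a space $Z$, some neighborhood of $X$ in $Z$ retracts onto $X$; an ANR $X$ is an *absolute retract* (AR) if, whenever $X$ is embedded as a closed subset of a space $Z$, it is a retract of $Z$ (so an AR is nonempty). An action of a group $G$ on a metric space $X$ is *geometric* if it is by isometries, cocompact (there is a compact $K\subseteq X$ with $GK=X$), and proper (for every compact $K\subseteq X$ the set $\{g\in G\mid gK\cap K\neq\varnothing\}$ is finite). A function $f:X\to Y$ of metric spaces, not necessarily continuous, is *coarse* if preimages of bounded sets are bounded and for every $R>0$ there is $S>0$ such that $d(x,x')<R$ implies $d(f(x),f(x'))<S$; a coarse function $f$ is a *coarse equivalence* if there are a coarse function $g:Y\to X$ and a constant $C$ with $d(gf(x),x)\le C$ and $d(fg(y),y)\le C$ for all $x\in X$, $y\in Y$. A homotopy $H:X\times[0,1]\to Y$ is *bounded* if the diameters of the sets $H(\{x\}\times[0,1])$, $x\in X$, are bounded above, and *proper* if it is continuous and preimages of compact sets are compact; two continuous maps are *boundedly* (resp. *properly*)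 homotopic if there is a bounded (resp. proper) homotopy between them. **Corollary.** Let $G$ be a group (possibly with torsion; the actions need not be free) which acts geometrically on proper metric ARs $X$ and $Y$. Then there exist continuous maps $f:X\to Y$ and $g:Y\to X$, both coarse equivalences, such that $gf$ and $fg$ are properly homotopic to $\operatorname{id}_X$ and $\operatorname{id}_Y$, respectively (so that $X$ and $Y$ are proper homotopy equivalent via $f$ and $g$), and $gf$ and $fg$ are boundedly homotopic to $\operatorname{id}_X$ and $\operatorname{id}_Y$, respectively. -/

import Mathlib

open scoped Topology unitInterval

universe u v w

/-- A locally compact (separable metrizable) space `X` is an *absolute neighborhood retract* if,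
whenever `X` is embedded as a closed subset of a separable metrizable space `Y`, some neighborhood
of (the image of) `X` in `Y` retracts onto `X`.
(A separable metrizable space has a homeomorphic copy in every universe, so nothing is lost by
letting `Y` range over the universe of `X`.) -/
structure IsANR (X : Type u) [TopologicalSpace X] : Prop where
  metrizable : TopologicalSpace.MetrizableSpace X
  separable : TopologicalSpace.SeparableSpace X
  locallyCompact : LocallyCompactSpace X
  exists_retraction_nhds : ∀ (Y : Type u) [TopologicalSpace Y]
    [TopologicalSpace.MetrizableSpace Y] [TopologicalSpace.SeparableSpace Y] (i : X → Y),
    Topology.IsClosedEmbedding i →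
      ∃ U ∈ 𝓝ˢ (Set.range i), ∃ r : C(U, X), ∀ (x : X) (hx : i x ∈ U), r ⟨i x, hx⟩ = x

/-- An ANR `X` is an *absolute retract* if, whenever `X` is embedded as a closed subset of a
separable metrizable space `Y`, its image is a retract of `Y`. (In particular `X` is nonempty.) -/
structure IsAR (X : Type u) [TopologicalSpace X] : Prop where
  isANR : IsANR X
  exists_retraction : ∀ (Y : Type u) [TopologicalSpace Y]
    [TopologicalSpace.MetrizableSpace Y] [TopologicalSpace.SeparableSpace Y] (i : X → Y),
    Topology.IsClosedEmbedding i → ∃ r : C(Y, X), ∀ x : X, r (i x) = x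

/-- The action of the (discrete) group `G` on the metric space `X` is *geometric*: it is by
isometries, cocompact and proper. -/
structure IsGeometricAction (G : Type w) (X : Type u) [Group G] [MetricSpace X]
    [MulAction G X] : Prop where
  isometry : ∀ g : G, Isometry (fun x : X => g • x)
  cocompact : ∃ K : Set X, IsCompact K ∧ ⋃ g : G, (fun x : X => g • x) '' K = Set.univ
  proper : ∀ K : Set X, IsCompact K → {g : G | ((fun x : X => g • x) '' K ∩ K).Nonempty}.Finite

section Coarse

variable {X : Type u} {Y : Type v} [MetricSpace X] [MetricSpace Y]

/-- Preimages of bounded sets are bounded. -/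
def MetricallyProper (f : X → Y) : Prop :=
  ∀ B : Set Y, Bornology.IsBounded B → Bornology.IsBounded (f ⁻¹' B)

/-- Large-scale uniform, also called bornologous. -/
def LargeScaleUniform (f : X → Y) : Prop :=
  ∀ R : ℝ, 0 < R → ∃ S : ℝ, 0 < S ∧ ∀ x x' : X, dist x x' < R → dist (f x) (f x') < S

def BoundedlyClose (f g : X → Y) : Prop :=
  ∃ C : ℝ, ∀ x : X, dist (f x) (g x) ≤ C

/-- A coarse map (not necessarily continuous). -/
def IsCoarseMap (f : X → Y) : Prop :=
  MetricallyProper f ∧ LargeScaleUniform f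

/-- A coarse equivalence: a coarse map that has a coarse inverse. -/
def IsCoarseEquivalence (f : X → Y) : Prop :=
  IsCoarseMap f ∧
    ∃ g : Y → X, IsCoarseMap g ∧ BoundedlyClose (g ∘ f) id ∧ BoundedlyClose (f ∘ g) id

/-- There is a homotopy from `f` to `g` whose tracks are uniformly bounded in diameter. -/
def BoundedlyHomotopic (f g : C(X, Y)) : Prop :=
  ∃ H : ContinuousMap.Homotopy f g, ∃ C : ℝ, ∀ (x : X) (s t : I), dist (H (s, x)) (H (t, x)) ≤ C

/-- There is a homotopy from `f` to `g` that is a proper map on `I × X`. -/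
def ProperlyHomotopic (f g : C(X, Y)) : Prop :=
  ∃ H : ContinuousMap.Homotopy f g, IsProperMap (fun p : I × X => H p)

/-- `f` and `g` are proper homotopy equivalences that are inverse to each other: both composites
are homotopic, via proper homotopies, to the identities. -/
def AreProperHomotopyInverse (f : C(X, Y)) (g : C(Y, X)) : Prop :=
  ProperlyHomotopic (g.comp f) (ContinuousMap.id X) ∧
    ProperlyHomotopic (f.comp g) (ContinuousMap.id Y)

end Coarse

/-! A proper AR is contractible. Translating one contraction of `Y` to `q` by `g : G` gives
contractions to the points `g • q`, all with the same metric control. For each `x : X`, compose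
these in a fixed order, running the `g`-th up to time `t * μ g x`, where `μ g` is a bump function
around `g • p`. At `t = 0` this is the identity; at `t = 1` it is constant, since some `μ g x = 1`;
bounded multiplicity keeps it controlled (`exists_parametrized_contraction`). The constants form a
continuous `f : X → Y` that follows `g • p ↦ g • q` up to bounded error, and every other such map is
boundedly homotopic to `f` (`IsGeometricAction.exists_tracksOrbits`). Round trips and identities
both track orbits, hence are boundedly homotopic. Exact equivariance is never needed, so torsion and
fixed points do no harm. -/

section Contractions

/-! ### Composing contractions with cut-off times -/

variable {ι : Type*} {X : Type*} {Y : Type*}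

/-- The composite of the self-maps `c i (t * μ i x)` of `Y`, where `i` runs through the list. -/
def composeContractions (c : ι → I × Y → Y) (μ : ι → X → I) (L : List ι) (t : I) (x : X) (y : Y) :
    Y :=
  L.foldr (fun i z => c i (t * μ i x, z)) y

variable {c : ι → I × Y → Y} {μ : ι → X → I}

lemma composeContractions_zero (hc : ∀ i y, c i (0, y) = y) (L : List ι) (x : X) (y : Y) :
    composeContractions c μ L 0 x y = y := by
  induction L with
  | nil => rfl
  | cons i L ih =>
    change c i (0 * μ i x, composeContractions c μ L 0 x y) = y
    rw [ih, zero_mul, hc]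

/-- A contraction run to its end forgets its input, and the outer ones only see its output. -/
lemma composeContractions_one {p : ι → Y} (hc : ∀ i y, c i (1, y) = p i) {L : List ι} {x : X}
    (hL : ∃ i ∈ L, μ i x = 1) (y y' : Y) :
    composeContractions c μ L 1 x y = composeContractions c μ L 1 x y' := by
  induction L with
  | nil => simp at hL
  | cons i L ih =>
    change c i (1 * μ i x, composeContractions c μ L 1 x y) =
      c i (1 * μ i x, composeContractions c μ L 1 x y')
    by_cases hi : μ i x = 1
    · rw [hi, one_mul, hc, hc]
    · rw [ih]
      obtain ⟨j, hj, hjx⟩ := hL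
      rcases List.mem_cons.1 hj with rfl | hj
      · exact absurd hjx hi
      · exact ⟨j, hj, hjx⟩

lemma composeContractions_filter (hc : ∀ i y, c i (0, y) = y) (L : List ι) (P : ι → Prop)
    [DecidablePred P] (t : I) {x : X} (hP : ∀ i, ¬ P i → μ i x = 0) (y : Y) :
    composeContractions c μ (L.filter P) t x y = composeContractions c μ L t x y := by
  induction L with
  | nil => rfl
  | cons i L ih =>
    by_cases hi : P i
    · rw [List.filter_cons_of_pos (by simpa using hi)]
      exact congrArg (fun z => c i (t * μ i x, z)) ih
    · rw [List.filter_cons_of_neg (by simpa using hi), ih]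
      change _ = c i (t * μ i x, composeContractions c μ L t x y)
      rw [hP i hi, mul_zero, hc]

lemma continuous_composeContractions [TopologicalSpace X] [TopologicalSpace Y]
    (hc : ∀ i, Continuous (c i)) (hμ : ∀ i, Continuous (μ i)) (L : List ι) :
    Continuous fun q : I × X × Y => composeContractions c μ L q.1 q.2.1 q.2.2 := by
  induction L with
  | nil => exact continuous_snd.comp continuous_snd
  | cons i L ih =>
    change Continuous fun q : I × X × Y =>
      c i (q.1 * μ i q.2.1, composeContractions c μ L q.1 q.2.1 q.2.2)
    have := hc i
    have := hμ i
    fun_prop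

/-- Centres active at the same `x` are within `D` of each other, so each step can be recentred at
its own contraction; the bound depends only on the number of steps. -/
lemma exists_dist_composeContractions_le [PseudoMetricSpace Y] {p : ι → Y} {D : ℝ}
    (hD : ∀ x i j, μ i x ≠ 0 → μ j x ≠ 0 → dist (p i) (p j) ≤ D)
    (hc : ∀ R, ∃ S, ∀ i t y, dist y (p i) ≤ R → dist (c i (t, y)) (p i) ≤ S) (R : ℝ) (n : ℕ) :
    ∃ S, ∀ (L : List ι) (t : I) (x : X) (y : Y) (j : ι), L.length ≤ n → (∀ i ∈ L, μ i x ≠ 0) →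
      μ j x ≠ 0 → dist y (p j) ≤ R → dist (composeContractions c μ L t x y) (p j) ≤ S := by
  induction n with
  | zero =>
    refine ⟨R, fun L t x y j hL _ _ hy => ?_⟩
    obtain rfl := List.length_eq_zero_iff.1 (Nat.le_zero.1 hL)
    exact hy
  | succ n ih =>
    obtain ⟨S, hS⟩ := ih
    obtain ⟨T, hT⟩ := hc (S + D)
    refine ⟨max R (T + D), fun L t x y j hL hLx hj hy => ?_⟩
    cases L with
    | nil => exact le_max_of_le_left hy
    | cons i L =>
      have hi : μ i x ≠ 0 := hLx i (by simp)
      have h1 := hS L t x y j (by simpa using hL) (fun k hk => hLx k (by simp [hk])) hj hy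
      have h2 : dist (composeContractions c μ L t x y) (p i) ≤ S + D :=
        (dist_triangle _ (p j) _).trans (add_le_add h1 (hD x j i hj hi))
      exact le_max_of_le_right ((dist_triangle _ (p i) _).trans
        (add_le_add (hT i (t * μ i x) _ h2) (hD x i j hi hj)))

/-- Given contractions `c i` of `Y` to points `p i` and a locally finite family of bounded
multiplicity of functions `μ i` on `X` that attain the value `1` at every point, there is a
family of homotopies of self-maps of `Y`, parametrized by `X`, from the identity to constant maps. -/
theorem exists_parametrized_contraction [TopologicalSpace X] [PseudoMetricSpace Y] {p : ι → Y}
    (hcc : ∀ i, Continuous (c i)) (hc0 : ∀ i y, c i (0, y) = y) (hc1 : ∀ i y, c i (1, y) = p i)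
    (hc : ∀ R, ∃ S, ∀ i t y, dist y (p i) ≤ R → dist (c i (t, y)) (p i) ≤ S)
    (hμc : ∀ i, Continuous (μ i)) (hμ : LocallyFinite fun i => {x | μ i x ≠ 0})
    (hμ1 : ∀ x, ∃ i, μ i x = 1) (hn : ∃ n, ∀ x, {i | μ i x ≠ 0}.ncard ≤ n)
    (hD : ∃ D, ∀ x i j, μ i x ≠ 0 → μ j x ≠ 0 → dist (p i) (p j) ≤ D) :
    ∃ J : I × X × Y → Y, Continuous J ∧ (∀ x y, J (0, x, y) = y) ∧
      (∀ x y y', J (1, x, y) = J (1, x, y')) ∧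
      ∀ R, ∃ S, ∀ t x y i, μ i x ≠ 0 → dist y (p i) ≤ R → dist (J (t, x, y)) (p i) ≤ S := by
  classical
  -- Any linear order will do: it makes the lists for nearby `x` sublists of one sorted list, up to
  -- factors that are the identity, whence continuity.
  let _ : LinearOrder ι := linearOrderOfSTO (WellOrderingRel (α := ι))
  obtain ⟨n, hn⟩ := hn
  obtain ⟨D, hD⟩ := hD
  have hfin : ∀ x, {i | μ i x ≠ 0}.Finite := fun x => hμ.point_finite x
  refine ⟨fun q => composeContractions c μ ((hfin q.2.1).toFinset.sort) q.1 q.2.1 q.2.2,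
    ?_, fun x y => composeContractions_zero hc0 _ x y, fun x y y' => ?_, fun R => ?_⟩
  · rw [continuous_iff_continuousAt]
    rintro ⟨t₀, x₀, y₀⟩
    obtain ⟨U, hU, hUf⟩ := hμ x₀
    refine ((continuous_composeContractions hcc hμc (hUf.toFinset.sort (· ≤ ·))).continuousAt).congr ?_
    have hU' : ∀ᶠ q : I × X × Y in 𝓝 (t₀, x₀, y₀), q.2.1 ∈ U :=
      (continuous_fst.comp continuous_snd).continuousAt hU
    filter_upwards [hU'] with q hq
    rw [← composeContractions_filter hc0 (hUf.toFinset.sort (· ≤ ·)) (fun i => μ i q.2.1 ≠ 0) q.1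
      (fun i hi => not_not.1 hi) q.2.2]
    congr 1
    refine List.Perm.eq_of_pairwise' (r := (· ≤ ·)) ?_ ?_ ?_
    · exact (Finset.pairwise_sort _ _).filter _
    · exact Finset.pairwise_sort _ _
    · rw [List.perm_ext_iff_of_nodup ((Finset.sort_nodup _ _).filter _) (Finset.sort_nodup _ _)]
      intro i
      simp only [List.mem_filter, Finset.mem_sort, Set.Finite.mem_toFinset, Set.mem_ofPred_eq,
        decide_eq_true_eq, and_iff_right_iff_imp]
      exact fun hi => ⟨q.2.1, hi, hq⟩
  · obtain ⟨i, hi⟩ := hμ1 x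
    refine composeContractions_one hc1 ⟨i, ?_, hi⟩ y y'
    simp [hi]
  · obtain ⟨S, hS⟩ := exists_dist_composeContractions_le hD hc R n
    refine ⟨S, fun t x y i hi hy => hS _ t x y i ?_ ?_ hi hy⟩
    · rw [Finset.length_sort, ← Set.ncard_eq_toFinset_card _ (hfin x)]
      exact hn x
    · simp

end Contractions

/-! ### Contractibility of proper absolute retracts -/

section AbsoluteRetracts

lemma IsAR.nonempty {X : Type u} [TopologicalSpace X] (hX : IsAR X) : Nonempty X := by
  by_contra h
  rw [not_nonempty_iff] at h
  obtain ⟨r, -⟩ := hX.exists_retraction PUnit isEmptyElim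
    ⟨⟨⟨Subsingleton.elim _ _⟩, fun a => isEmptyElim a⟩, by simp [Set.range_eq_empty]⟩
  exact isEmptyElim (r PUnit.unit)

/-- Distances to a dense sequence separate points, and the first coordinate alone is proper because
closed balls are compact. -/
lemma isClosedEmbedding_dist_denseSeq (X : Type u) [MetricSpace X] [ProperSpace X] [Nonempty X] :
    Topology.IsClosedEmbedding fun (x : X) (n : ℕ) => dist x (TopologicalSpace.denseSeq X n) := by
  have hcont : Continuous fun (x : X) (n : ℕ) => dist x (TopologicalSpace.denseSeq X n) := by
    fun_prop
  refine .of_continuous_injective_isClosedMap hcont (fun x y hxy => ?_)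
    (isProperMap_of_comp_of_t2 hcont (continuous_apply 0) ?_).isClosedMap
  · by_contra hne
    obtain ⟨n, hn⟩ := (TopologicalSpace.denseRange_denseSeq X).exists_dist_lt x
      (half_pos (dist_pos.2 hne))
    have h1 := congrFun hxy n
    have h2 := dist_triangle_right x y (TopologicalSpace.denseSeq X n)
    linarith
  · rw [isProperMap_iff_isCompact_preimage]
    refine ⟨by fun_prop, fun K hK => ?_⟩
    obtain ⟨R, hR⟩ := hK.isBounded.subset_closedBall 0
    refine (isCompact_closedBall (TopologicalSpace.denseSeq X 0) R).of_isClosed_subset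
      (hK.isClosed.preimage (by fun_prop)) fun x hx => ?_
    have := hR hx
    rw [mem_closedBall_zero_iff, Real.norm_eq_abs] at this
    exact Metric.mem_closedBall.2 ((le_abs_self _).trans this)

/-- A proper metric absolute retract is contractible to each of its points. -/
lemma IsAR.exists_contraction {X : Type u} [MetricSpace X] [ProperSpace X] (hX : IsAR X) (x₀ : X) :
    ∃ h : I × X → X, Continuous h ∧ (∀ x, h (0, x) = x) ∧ ∀ x, h (1, x) = x₀ := by
  have : Nonempty X := ⟨x₀⟩
  let e := (Homeomorph.ulift.{u} (X := ℕ → ℝ)).symm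
  have : TopologicalSpace.MetrizableSpace (ULift.{u} (ℕ → ℝ)) :=
    e.symm.isEmbedding.metrizableSpace
  have : TopologicalSpace.SeparableSpace (ULift.{u} (ℕ → ℝ)) :=
    e.surjective.denseRange.separableSpace e.continuous
  obtain ⟨r, hr⟩ := hX.exists_retraction (ULift.{u} (ℕ → ℝ)) _
    (e.isClosedEmbedding.comp (isClosedEmbedding_dist_denseSeq X))
  set i : X → ℕ → ℝ := fun x n => dist x (TopologicalSpace.denseSeq X n)
  have hi : Continuous i := by fun_prop
  have he : Continuous e := e.continuous
  -- The straight-line homotopy in `ℕ → ℝ`, pushed back to `X` by the retraction.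
  refine ⟨fun q => r (e ((1 - (q.1 : ℝ)) • i q.2 + (q.1 : ℝ) • i x₀)), by fun_prop,
    fun x => ?_, fun x => ?_⟩
  · simpa using hr x
  · simpa using hr x₀

end AbsoluteRetracts

/-! ### Bounded and proper homotopies -/

section Homotopies

variable {X : Type*} {Y : Type*} [MetricSpace X] [MetricSpace Y]

lemma BoundedlyHomotopic.symm {f g : C(X, Y)} (h : BoundedlyHomotopic f g) :
    BoundedlyHomotopic g f := by
  obtain ⟨H, C, hC⟩ := h
  exact ⟨H.symm, C, fun x s t => hC x (σ s) (σ t)⟩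

lemma BoundedlyHomotopic.trans {f₀ f₁ f₂ : C(X, Y)} (h : BoundedlyHomotopic f₀ f₁)
    (h' : BoundedlyHomotopic f₁ f₂) : BoundedlyHomotopic f₀ f₂ := by
  obtain ⟨F, C, hC⟩ := h
  obtain ⟨F', C', hC'⟩ := h'
  have key : ∀ x s t, dist (F (s, x)) (F' (t, x)) ≤ C + C' := fun x s t => by
    have h1 := hC x s 1
    have h2 := hC' x 0 t
    rw [F.apply_one] at h1
    rw [F'.apply_zero] at h2
    exact (dist_triangle _ _ _).trans (add_le_add h1 h2)
  refine ⟨F.trans F', C + C', fun x s t => ?_⟩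
  have h0 : 0 ≤ C := dist_nonneg.trans (hC x 0 0)
  have h0' : 0 ≤ C' := dist_nonneg.trans (hC' x 0 0)
  simp only [ContinuousMap.Homotopy.trans_apply]
  split_ifs
  · exact (hC x _ _).trans (le_add_of_nonneg_right h0')
  · exact key x _ _
  · rw [dist_comm]
    exact key x _ _
  · exact (hC' x _ _).trans (le_add_of_nonneg_left h0)

/-- A track that meets `K` ends at `x`, so `x` lies within `C` of `K`. -/
lemma BoundedlyHomotopic.properlyHomotopic_id [ProperSpace X] {f : C(X, X)}
    (h : BoundedlyHomotopic f (ContinuousMap.id X)) :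
    ProperlyHomotopic f (ContinuousMap.id X) := by
  obtain ⟨H, C, hC⟩ := h
  refine ⟨H, isProperMap_iff_isCompact_preimage.2 ⟨H.continuous, fun K hK => ?_⟩⟩
  refine (isCompact_univ.prod (hK.isBounded.cthickening (δ := C)).isCompact_closure
    ).of_isClosed_subset (hK.isClosed.preimage H.continuous) fun ⟨t, x⟩ hx => ⟨trivial, ?_⟩
  have h1 := hC x 1 t
  rw [H.apply_one] at h1
  exact subset_closure (Metric.mem_cthickening_of_dist_le _ _ _ _ hx h1)

end Homotopies

/-! ### Orbits of geometric actions -/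

section Actions

variable {G : Type*} [Group G] {X : Type*} [MetricSpace X] [MulAction G X]
  {Y : Type*} [MetricSpace Y] [MulAction G Y]

lemma IsGeometricAction.exists_dist_smul_le (hX : IsGeometricAction G X) (p : X) :
    ∃ R, ∀ x : X, ∃ g : G, dist x (g • p) ≤ R := by
  obtain ⟨K, hK, hKX⟩ := hX.cocompact
  obtain ⟨R, hR⟩ := hK.isBounded.subset_closedBall p
  refine ⟨R, fun x => ?_⟩
  have hx : x ∈ ⋃ g : G, (fun x : X => g • x) '' K := hKX ▸ Set.mem_univ x
  obtain ⟨g, k, hk, rfl⟩ := Set.mem_iUnion.1 hx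
  exact ⟨g, ((hX.isometry g).dist_eq k p).trans_le (hR hk)⟩

lemma IsGeometricAction.finite_dist_smul_le [ProperSpace X] (hX : IsGeometricAction G X)
    (p x : X) (R : ℝ) :
    {g : G | dist x (g • p) ≤ R}.Finite := by
  refine (hX.proper (Metric.closedBall p (max 0 (dist p x + R)))
    (isCompact_closedBall _ _)).subset fun g hg => ⟨g • p, ⟨p, ?_, rfl⟩, ?_⟩
  · exact Metric.mem_closedBall_self (le_max_left _ _)
  · rw [Metric.mem_closedBall']
    exact le_max_of_le_right ((dist_triangle _ x _).trans (add_le_add_right hg _))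

lemma IsGeometricAction.dist_smul_smul (hX : IsGeometricAction G X) (g g' : G) (p : X) :
    dist (g • p) (g' • p) = dist p ((g⁻¹ * g') • p) := by
  rw [← (hX.isometry g).dist_eq p, smul_smul, mul_inv_cancel_left]

/-- Any two orbit maps of geometric actions are coarsely equivalent. -/
lemma IsGeometricAction.exists_dist_orbit_le [ProperSpace X]
    (hX : IsGeometricAction G X) (hY : IsGeometricAction G Y) (p : X) (q : Y) (R : ℝ) :
    ∃ S, ∀ g g' : G, dist (g • p) (g' • p) ≤ R → dist (g • q) (g' • q) ≤ S := by
  -- Both distances depend only on `g⁻¹ * g'`, which ranges over a finite set.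
  obtain ⟨S, hS⟩ := ((hX.finite_dist_smul_le p p R).image fun g => dist q (g • q)).bddAbove
  refine ⟨S, fun g g' h => ?_⟩
  rw [hX.dist_smul_smul] at h
  rw [hY.dist_smul_smul]
  exact hS ⟨_, h, rfl⟩

variable (G) in
/-- The map `f` is, uniformly on balls around the orbit of `p`, at bounded distance from the
equivariant map of orbits that sends `p` to `q`. -/
def TracksOrbits (p : X) (q : Y) (f : X → Y) : Prop :=
  ∀ R, ∃ S, ∀ (x : X) (g : G), dist x (g • p) ≤ R → dist (f x) (g • q) ≤ S

end Actions

/-! ### Maps that track orbits -/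

section Tracking

variable {G : Type*} [Group G] {X : Type*} [MetricSpace X] [MulAction G X]
  {Y : Type*} [MetricSpace Y] [MulAction G Y] {Z : Type*} [MetricSpace Z] [MulAction G Z]
  {p : X} {q : Y} {z : Z}

lemma TracksOrbits.id (p : X) : TracksOrbits G p p (id : X → X) :=
  fun R => ⟨R, fun _ _ h => h⟩

lemma TracksOrbits.comp {f : X → Y} {f' : Y → Z} (hf' : TracksOrbits G q z f')
    (hf : TracksOrbits G p q f) : TracksOrbits G p z (f' ∘ f) := fun R => by
  obtain ⟨S, hS⟩ := hf R
  obtain ⟨T, hT⟩ := hf' S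
  exact ⟨T, fun x g h => hT _ g (hS x g h)⟩

lemma TracksOrbits.boundedlyClose (hX : IsGeometricAction G X) {f f' : X → Y}
    (hf : TracksOrbits G p q f) (hf' : TracksOrbits G p q f') : BoundedlyClose f f' := by
  obtain ⟨R, hR⟩ := hX.exists_dist_smul_le p
  obtain ⟨S, hS⟩ := hf R
  obtain ⟨S', hS'⟩ := hf' R
  refine ⟨S + S', fun x => ?_⟩
  obtain ⟨g, hg⟩ := hR x
  exact (dist_triangle_right _ _ (g • q)).trans (add_le_add (hS x g hg) (hS' x g hg))

lemma TracksOrbits.isCoarseMap (hX : IsGeometricAction G X) {f : X → Y} {f' : Y → X}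
    (hf : TracksOrbits G p q f) (hf' : TracksOrbits G q p f') : IsCoarseMap f := by
  constructor
  · intro B hB
    obtain ⟨r, hr⟩ := hB.subset_closedBall q
    obtain ⟨S, hS⟩ := hf' r
    obtain ⟨C, hC⟩ := (hf'.comp hf).boundedlyClose hX (TracksOrbits.id p)
    refine (Metric.isBounded_closedBall (x := p) (r := C + S)).subset fun x hx => ?_
    have h1 := hS (f x) 1 (by simpa using hr hx)
    have h2 := hC x
    rw [one_smul] at h1
    rw [dist_comm] at h2
    exact (dist_triangle x _ p).trans (add_le_add h2 h1)
  · intro R _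
    obtain ⟨R₀, hR₀⟩ := hX.exists_dist_smul_le p
    obtain ⟨S, hS⟩ := hf (R + R₀)
    refine ⟨max 1 (S + S + 1), by positivity, fun x x' h => lt_max_of_lt_right ?_⟩
    obtain ⟨g, hg⟩ := hR₀ x'
    have h1 := hS x g ((dist_triangle _ x' _).trans (add_le_add h.le hg))
    have h2 := hS x' g (hg.trans (le_add_of_nonneg_left (dist_nonneg.trans h.le)))
    linarith [dist_triangle_right (f x) (f x') (g • q)]

lemma TracksOrbits.isCoarseEquivalence (hX : IsGeometricAction G X)
    (hY : IsGeometricAction G Y) {f : X → Y} {f' : Y → X}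
    (hf : TracksOrbits G p q f) (hf' : TracksOrbits G q p f') : IsCoarseEquivalence f :=
  ⟨hf.isCoarseMap hX hf', f', hf'.isCoarseMap hY hf,
    (hf'.comp hf).boundedlyClose hX (TracksOrbits.id p),
    (hf.comp hf').boundedlyClose hY (TracksOrbits.id q)⟩

/-- A contraction of a proper space to a point has translates that move the points of any ball
around an orbit point by a bounded amount. -/
lemma IsGeometricAction.exists_dist_translate_le [ProperSpace Y] (hY : IsGeometricAction G Y)
    {h : I × Y → Y} (hh : Continuous h) (q : Y) (R : ℝ) :
    ∃ S, ∀ (g : G) (t : I) (y : Y), dist y (g • q) ≤ R →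
      dist (g • h (t, g⁻¹ • y)) (g • q) ≤ S := by
  obtain ⟨S, hS⟩ := ((isCompact_univ.prod (isCompact_closedBall q R)).image
    hh).isBounded.subset_closedBall q
  refine ⟨S, fun g t y hy => ?_⟩
  -- Translating by `g⁻¹` reduces to the ball around `q`, where compactness gives the bound.
  rw [(hY.isometry g).dist_eq]
  refine hS ⟨(t, g⁻¹ • y), ⟨trivial, ?_⟩, rfl⟩
  rwa [Metric.mem_closedBall, ← (hY.isometry g).dist_eq, smul_inv_smul]

/-- There is an invariant, locally finite family of bounded multiplicity of bump functions around
the points of an orbit that attains the value `1` at every point. -/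
lemma IsGeometricAction.exists_bump_functions [ProperSpace X] (hX : IsGeometricAction G X) (p : X) :
    ∃ (μ : G → X → I) (R : ℝ), (∀ g, Continuous (μ g)) ∧
      (∀ g x, μ g x ≠ 0 → dist x (g • p) ≤ R) ∧ (∀ x, ∃ g, μ g x = 1) ∧
      (LocallyFinite fun g => {x | μ g x ≠ 0}) ∧ ∃ n, ∀ x, {g | μ g x ≠ 0}.ncard ≤ n := by
  obtain ⟨R, hR⟩ := hX.exists_dist_smul_le p
  have hsupp : ∀ (g : G) (x : X), Set.projIcc (0 : ℝ) 1 zero_le_one (R + 1 - dist x (g • p)) ≠ 0 →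
      dist x (g • p) ≤ R + 1 := fun g x h => by
    by_contra! hlt
    exact h (Set.projIcc_of_le_left _ (by linarith))
  -- The bump is `1` within `R` of `g • p` and `0` beyond `R + 1`; `R`-balls around the orbit cover
  -- `X`.
  refine ⟨fun g x => Set.projIcc (0 : ℝ) 1 zero_le_one (R + 1 - dist x (g • p)), R + 1,
    fun g => continuous_projIcc.comp (by fun_prop), hsupp, fun x => ?_, fun x => ?_,
    {g : G | dist p (g • p) ≤ R + (R + 1)}.ncard, fun x => ?_⟩
  · obtain ⟨g, hg⟩ := hR x
    exact ⟨g, Set.projIcc_of_right_le _ (by linarith)⟩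
  · refine ⟨Metric.ball x 1, Metric.ball_mem_nhds x one_pos,
      (hX.finite_dist_smul_le p x (1 + (R + 1))).subset ?_⟩
    rintro g ⟨y, hy, hyx⟩
    exact (dist_triangle _ y _).trans
      (add_le_add (Metric.mem_ball'.1 hyx).le (hsupp g y hy))
  · obtain ⟨g₀, hg₀⟩ := hR x
    have hfin := hX.finite_dist_smul_le p p (R + (R + 1))
    refine (Set.ncard_le_ncard (fun g hg => ?_) (hfin.image (g₀ * ·))).trans
      (Set.ncard_image_le hfin)
    refine ⟨g₀⁻¹ * g, ?_, mul_inv_cancel_left g₀ g⟩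
    change dist p ((g₀⁻¹ * g) • p) ≤ _
    rw [← hX.dist_smul_smul]
    exact (dist_triangle_left _ _ x).trans (add_le_add hg₀ (hsupp g x hg))

/-- If `Y` is contractible, there is a continuous map `X → Y` tracking orbits to which every other
such map is boundedly homotopic. -/
theorem IsGeometricAction.exists_tracksOrbits [ProperSpace X] [ProperSpace Y]
    (hX : IsGeometricAction G X) (hY : IsGeometricAction G Y) (p : X) {q : Y} {h : I × Y → Y} (hh : Continuous h)
    (h0 : ∀ y, h (0, y) = y) (h1 : ∀ y, h (1, y) = q) :
    ∃ f : C(X, Y), TracksOrbits G p q f ∧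
      ∀ f' : C(X, Y), TracksOrbits G p q f' → BoundedlyHomotopic f' f := by
  obtain ⟨μ, R₀, hμc, hμR, hμ1, hμ, hn⟩ := hX.exists_bump_functions p
  have hsmul : ∀ g : G, Continuous fun y : Y => g • y := fun g => (hY.isometry g).continuous
  obtain ⟨J, hJ, hJ0, hJ1, hJS⟩ := exists_parametrized_contraction
    (c := fun (g : G) (r : I × Y) => g • h (r.1, g⁻¹ • r.2)) (μ := μ) (p := fun g => g • q)
    (fun g => (hsmul g).comp (hh.comp (continuous_fst.prodMk ((hsmul g⁻¹).comp continuous_snd))))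
    (fun g y => by rw [h0, smul_inv_smul]) (fun g y => by rw [h1])
    (hY.exists_dist_translate_le hh q) hμc hμ hμ1 hn (by
      obtain ⟨D, hD⟩ := hX.exists_dist_orbit_le hY p q (R₀ + R₀)
      exact ⟨D, fun x g g' hg hg' => hD g g' ((dist_triangle_left _ _ x).trans
        (add_le_add (hμR g x hg) (hμR g' x hg')))⟩)
  refine ⟨⟨fun x => J (1, x, q), by fun_prop⟩, fun R => ?_, fun f' hf' => ?_⟩
  · obtain ⟨S, hS⟩ := hJS 0
    obtain ⟨D, hD⟩ := hX.exists_dist_orbit_le hY p q (R₀ + R)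
    refine ⟨S + D, fun x g hg => ?_⟩
    obtain ⟨g₁, hg₁⟩ := hμ1 x
    have hne : μ g₁ x ≠ 0 := by simp [hg₁]
    refine (dist_triangle _ (g₁ • q) _).trans (add_le_add ?_ (hD g₁ g ?_))
    · change dist (J (1, x, q)) (g₁ • q) ≤ S
      -- The base point `q` may be far from `g₁ • q`, but the final map is constant, so the input
      -- can be moved there.
      rw [hJ1 x q (g₁ • q)]
      exact hS 1 x _ g₁ hne (dist_self _).le
    · exact (dist_triangle_left _ _ x).trans (add_le_add (hμR g₁ x hne) hg)
  · obtain ⟨T, hT⟩ := hf' R₀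
    obtain ⟨S, hS⟩ := hJS T
    refine ⟨{ toFun := fun r => J (r.1, r.2, f' r.2)
              continuous_toFun := by fun_prop
              map_zero_left := fun x => hJ0 x _
              map_one_left := fun x => hJ1 x _ _ }, S + S, fun x s t => ?_⟩
    obtain ⟨g, hg⟩ := hμ1 x
    have hne : μ g x ≠ 0 := by simp [hg]
    have hx := hT x g (hμR g x hne)
    exact (dist_triangle_right _ _ (g • q)).trans
      (add_le_add (hS s x _ g hne hx) (hS t x _ g hne hx))

end Tracking

theorem corollary1p2 {G : Type w} [Group G]
    {X : Type u} [MetricSpace X] [ProperSpace X] [MulAction G X]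
    {Y : Type v} [MetricSpace Y] [ProperSpace Y] [MulAction G Y]
    (hX : IsAR X) (hY : IsAR Y)
    (hGX : IsGeometricAction G X) (hGY : IsGeometricAction G Y) :
    ∃ (f : C(X, Y)) (g : C(Y, X)),
      AreProperHomotopyInverse f g ∧
      IsCoarseEquivalence (f : X → Y) ∧ IsCoarseEquivalence (g : Y → X) ∧
      BoundedlyHomotopic (g.comp f) (ContinuousMap.id X) ∧
      BoundedlyHomotopic (f.comp g) (ContinuousMap.id Y) := by
  obtain ⟨p⟩ := hX.nonempty
  obtain ⟨q⟩ := hY.nonempty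
  obtain ⟨h, hh, h0, h1⟩ := hX.exists_contraction p
  obtain ⟨k, hk, k0, k1⟩ := hY.exists_contraction q
  obtain ⟨f, hf, -⟩ := hGX.exists_tracksOrbits hGY p hk k0 k1
  obtain ⟨g, hg, -⟩ := hGY.exists_tracksOrbits hGX q hh h0 h1
  -- `e` is only an intermediary: `g.comp f` and the identity are both boundedly homotopic to it.
  obtain ⟨e, -, he⟩ := hGX.exists_tracksOrbits hGX p hh h0 h1
  obtain ⟨e', -, he'⟩ := hGY.exists_tracksOrbits hGY q hk k0 k1
  have hgf : BoundedlyHomotopic (g.comp f) (ContinuousMap.id X) :=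
    (he _ (hg.comp hf)).trans (he _ (TracksOrbits.id p)).symm
  have hfg : BoundedlyHomotopic (f.comp g) (ContinuousMap.id Y) :=
    (he' _ (hf.comp hg)).trans (he' _ (TracksOrbits.id q)).symm
  exact ⟨f, g, ⟨hgf.properlyHomotopic_id, hfg.properlyHomotopic_id⟩,
    hf.isCoarseEquivalence hGX hGY hg, hg.isCoarseEquivalence hGY hGX hf, hgf, hfg⟩
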